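/- A \emph{black box search tree} is a finite rooted tree in which no vertex has exactly one child, together with an ordering of the children of each vertex and a color in $\mathbb{N}$ for each leaf. A \emph{color-preserving isomorphism} between two such trees is a bijection of the vertex sets that preserves the child relation in both directions (not necessarily the orderings) and maps each leaf to a leaf of the same color. The inputs are pairs $(T_1,T_2)$ of black box search trees such that for all $i,j\in\{1,2\}$ and all leaves $l$ of $T_i$ and $l'$ of $T_j$ with the same color there is a color-preserving isomorphism from $T_i$ to $T_j$ that maps $l$ to $l'$. A randomized exploration algorithm accesses the hidden trees only as follows. At the beginning exactly the two roots are explored. When a vertex is explored, the algorithm learns its number of children and, if the vertex is a leaf, its color. The algorithm may request the $i$-th child of an explored vertex $v$ for any $1\le i\le \deg(v)$, where $\deg(v)$ is the number of children of $v$; that child then becomes explored. The algorithm may make uniformly random choices from finite sets, and it is otherwise an arbitrary strategy. Its cost is the number of vertices, other than the two initially known roots, that it explores; returning to explored vertices and internal computation cost nothing. The \emph{isomorphism exploration problem} is to output explored leaves $l_1$ of $T_1$ and $l_2$ of $T_2$ of equal color if the trees have leaves of equal color, and $\bot$ otherwise. \textbf{Theorem.} There are a randomized exploration algorithm and a constant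 $C>0$ such that on every input $(T_1,T_2)$ the algorithm halts with probability $1$, never gives an incorrect output, and has expected cost at most $$C\cdot d\cdot \log_2\bigl(\max\{\sqrt{|T_1|},\sqrt{|T_2|}\}\bigr)\cdot \min\{\sqrt{|T_1|},\sqrt{|T_2|}\},$$ where $|T_i|$ is the number of vertices of $T_i$ and $d$ is the maximum number of children of a vertex in $T_1$ or $T_2$. The algorithm is not given $d$, $|T_1|$ or $|T_2|$. -/

import Mathlib

open scoped ENNReal

/-- A finite rooted tree with an ordering of the children of every node, in which no node has
exactly one child and every leaf carries a colour in `ℕ`. The node `inner n f` has the `n + 2`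
children `f 0, …, f (n + 1)`. -/
inductive SearchTree : Type
  | leaf (color : ℕ) : SearchTree
  | inner (n : ℕ) (child : Fin (n + 2) → SearchTree) : SearchTree

/-- What becomes known about a node when it is explored: a leaf shows its colour, an inner node
shows its number of children. -/
inductive NodeInfo : Type
  | leaf (color : ℕ) : NodeInfo
  | inner (degree : ℕ) : NodeInfo

namespace SearchTree

/-- The number of vertices. -/
def size : SearchTree → ℕ
  | leaf _ => 1
  | inner _ f => 1 + ∑ i, (f i).size

/-- The largest number of children of a vertex. -/
def maxDegree : SearchTree → ℕ
  | leaf _ => 0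
  | inner n f => max (n + 2) (Finset.univ.sup fun i => (f i).maxDegree)

/-- The information shown by the root. -/
def info : SearchTree → NodeInfo
  | leaf c => .leaf c
  | inner n _ => .inner (n + 2)

/-- Vertices are addressed by the list of child indices on the path from the root;
`T.subtree? p` is the subtree rooted at the vertex with address `p`, if there is one. -/
def subtree? : SearchTree → List ℕ → Option SearchTree
  | T, [] => some T
  | leaf _, _ :: _ => none
  | inner n f, i :: p => if h : i < n + 2 then (f ⟨i, h⟩).subtree? p else none

/-- The colour of the vertex with address `p`, if it is a leaf of `T`. -/
def colorAt (T : SearchTree) (p : List ℕ) : Option ℕ :=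
  match T.subtree? p with
  | some (leaf c) => some c
  | _ => none

/-- The vertex set. -/
def Vert (T : SearchTree) : Type := {p : List ℕ // (T.subtree? p).isSome}

/-- `w` is a child of `v`. -/
def IsChild {T : SearchTree} (w v : T.Vert) : Prop := ∃ i : ℕ, w.1 = v.1 ++ [i]

/-- A colour-preserving isomorphism: a bijection on vertices that preserves and reflects the child
relation (but not necessarily the ordering of the children) and preserves colours of leaves. -/
structure IsColorIso {S T : SearchTree} (φ : S.Vert ≃ T.Vert) : Prop where
  child : ∀ w v : S.Vert, IsChild w v ↔ IsChild (φ w) (φ v)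
  color : ∀ (v : S.Vert) (c : ℕ), S.colorAt v.1 = some c → T.colorAt (φ v).1 = some c

/-- Whenever a leaf of `S` and a leaf of `T` have the same colour, some colour-preserving
isomorphism maps the first to the second. -/
def Invariant (S T : SearchTree) : Prop :=
  ∀ (l : S.Vert) (l' : T.Vert) (c : ℕ), S.colorAt l.1 = some c → T.colorAt l'.1 = some c →
    ∃ φ : S.Vert ≃ T.Vert, IsColorIso φ ∧ φ l = l'

end SearchTree

/-- A move of an exploration algorithm with internal states in `σ`: request the `i`-th child
(counted from `0`) of the node `v` of tree number `t` and continue depending on the answer; draw a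
uniformly random element of a set of size `n + 1`; or stop with an output, which is either a pair of
nodes (one of each tree) or `none`, standing for `⊥`. -/
inductive Move (σ : Type) : Type
  | query (t : Fin 2) (v : List ℕ) (i : ℕ) (next : Option NodeInfo → σ) : Move σ
  | draw (n : ℕ) (next : Fin (n + 1) → σ) : Move σ
  | halt (out : Option (List ℕ × List ℕ)) : Move σ

/-- A randomized exploration algorithm for two hidden trees. Its only initial knowledge is the
information shown by the two roots; everything else it learns from answers to its queries. -/
structure ExplorationAlgorithm where
  State : Type
  start : NodeInfo → NodeInfo → State
  move : State → Move State

namespace ExplorationAlgorithm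

/-- A configuration of a run: the internal state and the set of explored nodes. -/
structure Config (A : ExplorationAlgorithm) where
  state : A.State
  explored : Finset (Fin 2 × List ℕ)

/-- The number of nodes explored by the algorithm (the roots are known from the beginning). -/
def Config.cost {A : ExplorationAlgorithm} (c : A.Config) : ℕ :=
  (c.explored.filter fun x => x.2 ≠ []).card

def Halted (A : ExplorationAlgorithm) (c : A.Config) : Prop :=
  ∃ out, A.move c.state = .halt out

/-- At the beginning exactly the two roots are explored. -/
def init (A : ExplorationAlgorithm) (T : Fin 2 → SearchTree) : A.Config :=
  ⟨A.start (T 0).info (T 1).info, {(0, []), (1, [])}⟩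

/-- One step. A request for an existing child of an explored node explores that child and is
answered with its information; every other request is refused (answer `none`). -/
noncomputable def step (A : ExplorationAlgorithm) (T : Fin 2 → SearchTree) (c : A.Config) :
    PMF A.Config :=
  match A.move c.state with
  | .halt _ => PMF.pure c
  | .draw n next => (PMF.uniformOfFintype (Fin (n + 1))).map fun j => ⟨next j, c.explored⟩
  | .query t v i next =>
    match (T t).subtree? (v ++ [i]) with
    | some u =>
      if (t, v) ∈ c.explored then
        PMF.pure ⟨next (some u.info), insert (t, v ++ [i]) c.explored⟩
      else PMF.pure ⟨next none, c.explored⟩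
    | none => PMF.pure ⟨next none, c.explored⟩

/-- The distribution of the configuration after `n` steps on input `T`. -/
noncomputable def run (A : ExplorationAlgorithm) (T : Fin 2 → SearchTree) : ℕ → PMF A.Config
  | 0 => PMF.pure (A.init T)
  | n + 1 => (A.run T n).bind (A.step T)

/-- The expected cost of a run on input `T`. The cost does not decrease along a run, so this is the
expectation of its final (or limiting) value. -/
noncomputable def expectedCost (A : ExplorationAlgorithm) (T : Fin 2 → SearchTree) : ℝ≥0∞ :=
  ⨆ n : ℕ, ∑' c : A.Config, A.run T n c * (c.cost : ℝ≥0∞)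

/-- `out` is a correct answer to the isomorphism exploration problem on input `T` when the set of
explored nodes is `E`: a pair of explored leaves of equal colour, or `⊥` if there is no pair of
equally coloured leaves in the two trees. -/
def CorrectOutput (T : Fin 2 → SearchTree) (E : Finset (Fin 2 × List ℕ)) :
    Option (List ℕ × List ℕ) → Prop
  | some (l₀, l₁) => (0, l₀) ∈ E ∧ (1, l₁) ∈ E ∧
      ∃ c, (T 0).colorAt l₀ = some c ∧ (T 1).colorAt l₁ = some c
  | none => ¬ ∃ l₀ l₁ c, (T 0).colorAt l₀ = some c ∧ (T 1).colorAt l₁ = some c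

/-- The algorithm solves the isomorphism exploration problem on input `T` without error: it halts
with probability one, and every output that occurs with positive probability is correct. -/
def SolvesWithoutError (A : ExplorationAlgorithm) (T : Fin 2 → SearchTree) : Prop :=
  Filter.Tendsto (fun n => (A.run T n).toOuterMeasure {c | A.Halted c}) Filter.atTop (nhds 1) ∧
  ∀ (n : ℕ), ∀ c ∈ (A.run T n).support, ∀ out, A.move c.state = .halt out →
    CorrectOutput T c.explored out

end ExplorationAlgorithm

/-! Two trees with a common leaf color are isomorphic. Give the root the weight `m = 2 ^ k` and
divide it by the degree, rounding down, at each step to a child; the frontier consists of the nodes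
where the weight first vanishes and the leaves met earlier. It depends on degrees only, so an
isomorphism carries frontier to frontier. Suppose that all leaves below one frontier node `v` of one
tree are known, and one arbitrary leaf below each frontier node of the other. If the trees share a
color, the image of `v` is among the latter nodes, and the color found below it occurs below `v`.
Hence comparing the two lists never gives a wrong answer, whatever the random choices.

Randomness only controls the cost. A uniform walk stops at a given inner frontier node with
probability at most `1 / (m + 1)`, so on average at most `(|T| - 1) / (m + 1)` vertices lie below
the chosen node (`rank_walkToFrontier_le`). If `|T| ≤ 4 ^ k`, a search with budget `4 * 2 ^ k` fails
with probability at most 1/4, by Markov. The other frontier has O(d m) nodes, and a random walk to a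
leaf has expected length at most the binary logarithm of the size (`walkRank_le`,
`rank_exploreFrontier_le`). Each phase tries both trees, then `k` grows by one. Once `4 ^ k` exceeds
the smaller size, phases double in cost but are followed by another with probability at most 1/4, so
the total is a convergent geometric series (`rank_phaseBody_le`).

Termination, correctness and cost all follow from one ranking function, `rank`, with value `⊤` at
errors (`solves_of_ranking`). -/

/-! ### Expectations in `ℝ≥0∞` -/

namespace PMF

/-- The expectation of a function with values in `ℝ≥0∞`. -/
noncomputable def expect {α : Type*} (μ : PMF α) (f : α → ℝ≥0∞) : ℝ≥0∞ := ∑' a, μ a * f a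

variable {α β : Type*}

theorem expect_pure (a : α) (f : α → ℝ≥0∞) : (PMF.pure a).expect f = f a := by
  classical
  rw [expect, tsum_eq_single a]
  · simp
  · intro b hb
    simp [PMF.pure_apply, hb]

theorem expect_bind (μ : PMF α) (g : α → PMF β) (f : β → ℝ≥0∞) :
    (μ.bind g).expect f = μ.expect fun a => (g a).expect f := by
  simp only [expect, PMF.bind_apply, ← ENNReal.tsum_mul_right, ← ENNReal.tsum_mul_left]
  rw [ENNReal.tsum_comm]
  simp only [mul_assoc]

theorem expect_map (μ : PMF α) (g : α → β) (f : β → ℝ≥0∞) :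
    (μ.map g).expect f = μ.expect fun a => f (g a) := by
  rw [← PMF.bind_pure_comp, expect_bind]
  simp only [Function.comp_apply, expect_pure]

theorem expect_mono (μ : PMF α) {f g : α → ℝ≥0∞} (h : ∀ a, f a ≤ g a) :
    μ.expect f ≤ μ.expect g :=
  ENNReal.tsum_le_tsum fun a => by gcongr; exact h a

theorem expect_add (μ : PMF α) (f g : α → ℝ≥0∞) :
    (μ.expect fun a => f a + g a) = μ.expect f + μ.expect g := by
  simp only [expect, mul_add, ENNReal.tsum_add]

theorem expect_const (μ : PMF α) (x : ℝ≥0∞) : (μ.expect fun _ => x) = x := by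
  simp only [expect, ENNReal.tsum_mul_right, PMF.tsum_coe, one_mul]

theorem expect_indicator (μ : PMF α) (s : Set α) :
    μ.expect (s.indicator 1) = μ.toOuterMeasure s := by
  rw [PMF.toOuterMeasure_apply, expect]
  refine tsum_congr fun a => ?_
  by_cases h : a ∈ s <;> simp [h]

theorem expect_uniform (n : ℕ) (f : Fin (n + 1) → ℝ≥0∞) :
    (PMF.uniformOfFintype (Fin (n + 1))).expect f = (∑ j, f j) / (n + 1 : ℕ) := by
  simp only [expect, PMF.uniformOfFintype_apply, tsum_fintype, Fintype.card_fin]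
  rw [← Finset.mul_sum, mul_comm, div_eq_mul_inv]

theorem lt_top_of_expect_lt_top {μ : PMF α} {f : α → ℝ≥0∞} (h : μ.expect f < ⊤) {a : α}
    (ha : a ∈ μ.support) : f a < ⊤ := by
  have h1 : μ a * f a < ⊤ := (ENNReal.le_tsum a).trans_lt h
  by_contra h2
  rw [not_lt, top_le_iff] at h2
  rw [h2, ENNReal.mul_top ((PMF.mem_support_iff _ _).1 ha)] at h1
  exact lt_irrefl _ h1

end PMF

/-! ### Ranking functions for exploration algorithms -/

namespace ExplorationAlgorithm

variable {A : ExplorationAlgorithm} {T : Fin 2 → SearchTree} {V : A.Config → ℝ≥0∞}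

theorem step_halted {c : A.Config} (hc : A.Halted c) : A.step T c = PMF.pure c := by
  obtain ⟨out, h⟩ := hc
  simp [step, h]

theorem cost_insert (s s' : A.State) (x : Fin 2 × List ℕ) (E : Finset (Fin 2 × List ℕ)) :
    (⟨s', insert x E⟩ : A.Config).cost ≤ (⟨s, E⟩ : A.Config).cost + 1 := by
  classical
  unfold Config.cost
  dsimp only
  rw [Finset.filter_insert]
  split_ifs
  · exact Finset.card_insert_le _ _
  · omega

theorem expect_cost_step (c : A.Config) :
    ((A.step T c).expect fun c' => (c'.cost : ℝ≥0∞)) ≤ c.cost + 1 := by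
  have key : ∀ s' : A.State, ((⟨s', c.explored⟩ : A.Config).cost : ℝ≥0∞) ≤ c.cost + 1 :=
    fun _ => le_self_add
  unfold step
  split
  · rw [PMF.expect_pure]
    exact le_self_add
  · rw [PMF.expect_map]
    exact (PMF.expect_mono _ fun _ => key _).trans_eq (PMF.expect_const _ _)
  · split
    · split_ifs
      · rw [PMF.expect_pure]
        exact_mod_cast cost_insert c.state _ _ c.explored
      · rw [PMF.expect_pure]
        exact key _
    · rw [PMF.expect_pure]
      exact key _

theorem expect_step_le (hV : ∀ c, ¬ A.Halted c → 1 + (A.step T c).expect V ≤ V c) (c : A.Config) :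
    {c | ¬ A.Halted c}.indicator 1 c + (A.step T c).expect V ≤ V c := by
  by_cases hc : A.Halted c
  · simp [hc, step_halted hc, PMF.expect_pure]
  · simpa [hc] using hV c hc

theorem expect_cost_add_step_le (hV : ∀ c, ¬ A.Halted c → 1 + (A.step T c).expect V ≤ V c)
    (c : A.Config) :
    ((A.step T c).expect fun c' => (c'.cost : ℝ≥0∞) + V c') ≤ c.cost + V c := by
  by_cases hc : A.Halted c
  · rw [step_halted hc, PMF.expect_pure]
  · rw [PMF.expect_add]
    calc _ ≤ (c.cost + 1 : ℝ≥0∞) + (A.step T c).expect V := by gcongr; exact expect_cost_step c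
      _ = c.cost + (1 + (A.step T c).expect V) := by ring
      _ ≤ _ := by gcongr; exact hV c hc

/-- The sum is the expected number of steps taken before halting among the first `n`; each of them
is paid for by a unit of `V`. -/
theorem sum_not_halted_le (hV : ∀ c, ¬ A.Halted c → 1 + (A.step T c).expect V ≤ V c) (n : ℕ) :
    (∑ k ∈ Finset.range n, (A.run T k).toOuterMeasure {c | ¬ A.Halted c}) + (A.run T n).expect V
      ≤ V (A.init T) := by
  induction n with
  | zero => simp [run, PMF.expect_pure]
  | succ n ih =>
    refine le_trans ?_ ih
    rw [Finset.sum_range_succ, add_assoc, run, PMF.expect_bind, ← PMF.expect_indicator,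
      ← PMF.expect_add]
    gcongr
    exact PMF.expect_mono _ (expect_step_le hV)

theorem expect_cost_run_le (hV : ∀ c, ¬ A.Halted c → 1 + (A.step T c).expect V ≤ V c) (n : ℕ) :
    ((A.run T n).expect fun c => (c.cost : ℝ≥0∞) + V c) ≤ V (A.init T) := by
  induction n with
  | zero => simp [run, PMF.expect_pure, init, Config.cost, Finset.filter_insert,
    Finset.filter_singleton]
  | succ n ih =>
    refine le_trans ?_ ih
    rw [run, PMF.expect_bind]
    exact PMF.expect_mono _ (expect_cost_add_step_le hV)

/-- A ranking function that decreases by one in expectation with each step, and is infinite at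
wrong outputs, bounds the expected cost and certifies that the algorithm makes no error. -/
theorem solves_of_ranking (hV : ∀ c, ¬ A.Halted c → 1 + (A.step T c).expect V ≤ V c)
    (hout : ∀ c out, A.move c.state = .halt out → V c < ⊤ → CorrectOutput T c.explored out)
    (hinit : V (A.init T) < ⊤) :
    A.SolvesWithoutError T ∧ A.expectedCost T ≤ V (A.init T) := by
  have hrun n : (A.run T n).expect V < ⊤ :=
    (le_add_self.trans (sum_not_halted_le hV n)).trans_lt hinit
  refine ⟨⟨?_, fun n c hc out ho => hout c out ho (PMF.lt_top_of_expect_lt_top (hrun n) hc)⟩, ?_⟩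
  -- The expected running time is finite, so the probabilities of still running are summable and
  -- tend to zero.
  · have hsum : (∑' k, (A.run T k).toOuterMeasure {c | ¬ A.Halted c}) ≠ ⊤ := by
      refine ne_top_of_le_ne_top hinit.ne ?_
      rw [ENNReal.tsum_eq_iSup_nat]
      exact iSup_le fun n => le_self_add.trans (sum_not_halted_le hV n)
    have h0 := ENNReal.tendsto_atTop_zero_of_tsum_ne_top hsum
    have hadd n : (A.run T n).toOuterMeasure {c | A.Halted c} =
        1 - (A.run T n).toOuterMeasure {c | ¬ A.Halted c} := by
      have h1 : (A.run T n).toOuterMeasure {c | A.Halted c} +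
          (A.run T n).toOuterMeasure {c | ¬ A.Halted c} = 1 := by
        rw [← PMF.expect_indicator, ← PMF.expect_indicator, ← PMF.expect_add,
          ← PMF.expect_const (A.run T n) 1]
        congr 1
        funext c
        by_cases hc : A.Halted c <;> simp [hc]
      refine ENNReal.eq_sub_of_add_eq (ne_top_of_le_ne_top ENNReal.one_ne_top ?_) h1
      exact le_add_self.trans_eq h1
    simp only [hadd]
    simpa using ENNReal.Tendsto.sub tendsto_const_nhds h0 (Or.inl ENNReal.one_ne_top)
  · refine iSup_le fun n => le_trans ?_ (expect_cost_run_le hV n)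
    exact PMF.expect_mono _ fun c => le_self_add

end ExplorationAlgorithm

/-! ### The search algorithm -/

/-- Programs of exploration algorithms. Besides the basic moves there are a random walk from an
inner node `v` with `n + 1` children down to a leaf, whose address and colour are passed on, and a
jump to the beginning of a phase of the main loop. -/
inductive Program : Type
  | query (t : Fin 2) (v : List ℕ) (i : ℕ) (next : NodeInfo → Program) : Program
  | draw (n : ℕ) (next : Fin (n + 1) → Program) : Program
  | walk (t : Fin 2) (v : List ℕ) (n : ℕ) (next : List ℕ → ℕ → Program) : Program
  | phase (k : ℕ) (roots : Fin 2 → NodeInfo) : Program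
  | halt (out : Option (List ℕ × List ℕ)) : Program

namespace Program

/-- Walk randomly to a leaf from the explored node `v`. -/
def descend (t : Fin 2) (v : List ℕ) (next : List ℕ → ℕ → Program) : NodeInfo → Program
  | .leaf c => next v c
  | .inner d => walk t v (d - 1) next

/-- Walk randomly from `v` to the first node at which the weight `m`, which is divided by the
degree in each step, vanishes, or to a leaf. -/
def walkToFrontier (t : Fin 2) (v : List ℕ) (m : ℕ) (info : NodeInfo)
    (next : List ℕ → NodeInfo → Program) : Program :=
  match info with
  | .leaf c => next v (.leaf c)
  | .inner d =>
    if hm : m = 0 then next v (.inner d)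
    -- Inner nodes have `d ≥ 2`, so `d - 2 + 2` is `d`; this form keeps the divisor at least 2 for
    -- every `d`, as termination requires.
    else draw (d - 1) fun j => query t v j fun info =>
      walkToFrontier t (v ++ [(j : ℕ)]) (m / (d - 2 + 2)) info next
termination_by m
decreasing_by exact Nat.div_lt_self (Nat.pos_of_ne_zero hm) (by omega)

/-- Explore everything below `v` down to the nodes at which the weight `m` vanishes, and one
random leaf below each of these; pass on the list of the leaves found. -/
def exploreFrontier (t : Fin 2) (v : List ℕ) (m : ℕ) (info : NodeInfo)
    (next : List (List ℕ × ℕ) → Program) : Program :=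
  match info with
  | .leaf c => next [(v, c)]
  | .inner d =>
    if hm : m = 0 then walk t v (d - 1) fun p c => next [(p, c)]
    else (List.range d).foldr (fun i rest found => query t v i fun info =>
      exploreFrontier t (v ++ [i]) (m / (d - 2 + 2)) info fun more => rest (found ++ more)) next []
termination_by m
decreasing_by exact Nat.div_lt_self (Nat.pos_of_ne_zero hm) (by omega)

/-- The pending requests for the children of the explored node `v`. -/
def childRequests (v : List ℕ) : NodeInfo → List (List ℕ × ℕ)
  | .leaf _ => []
  | .inner d => (List.range d).map fun i => (v, i)

/-- The explored node `v` together with its colour, if it is a leaf. -/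
def leafRecord (v : List ℕ) : NodeInfo → List (List ℕ × ℕ)
  | .leaf c => [(v, c)]
  | .inner _ => []

/-- Explore the pending children and everything below them by at most `B` requests; pass on the
list of the leaves found, or continue with `fail` if the requests do not suffice. -/
def depthFirst (t : Fin 2) (next : List (List ℕ × ℕ) → Program) (fail : Program) :
    ℕ → List (List ℕ × ℕ) → List (List ℕ × ℕ) → Program
  | _, [], found => next found
  | 0, _ :: _, _ => fail
  | B + 1, (v, i) :: pending, found => query t v i fun info =>
      depthFirst t next fail B (childRequests (v ++ [i]) info ++ pending)
        (leafRecord (v ++ [i]) info ++ found)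

/-- The output for lists of leaves found in the trees number `t` and `1 - t`. -/
def matchLeaves (t : Fin 2) (L L' : List (List ℕ × ℕ)) : Option (List ℕ × List ℕ) :=
  ((L.product L').find? fun x => x.1.2 == x.2.2).map fun x =>
    if t = 0 then (x.1.1, x.2.1) else (x.2.1, x.1.1)

/-- Search the subtree of tree number `t` at a random frontier node with a limited number of
requests; if it is finished, compare its leaves with one leaf below each frontier node of the other
tree. -/
def attempt (t : Fin 2) (roots : Fin 2 → NodeInfo) (k : ℕ) (fail : Program) : Program :=
  walkToFrontier t [] (2 ^ k) (roots t) fun v info =>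
    depthFirst t (fun L => exploreFrontier (1 - t) [] (2 ^ k) (roots (1 - t)) fun L' =>
      halt (matchLeaves t L L')) fail (4 * 2 ^ k) (childRequests v info) (leafRecord v info)

/-- The main loop. -/
def phaseBody (k : ℕ) (roots : Fin 2 → NodeInfo) : Program :=
  attempt 0 roots k (attempt 1 roots k (phase (k + 1) roots))

/-- A refused request ends the run with an arbitrary output; `rank` is `⊤` at such requests, so a
finite rank excludes them. The jump to a phase is a trivial draw and counts as one step. -/
def move : Program → Move Program
  | query t v i next => .query t v i fun o => o.elim (halt none) next
  | draw n next => .draw n next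
  | walk t v n next => .draw n fun j => query t v j fun info => descend t (v ++ [(j : ℕ)]) next info
  | phase k roots => .draw 0 fun _ => phaseBody k roots
  | halt out => .halt out

/-- Two single leaves need their own case: the claimed bound is then 0, so the answer must come
without exploration. -/
def start : NodeInfo → NodeInfo → Program
  | .leaf c, .leaf c' => halt (if c = c' then some ([], []) else none)
  | r, r' => phase 0 ![r, r']

end Program

/-- Search with geometrically growing effort. -/
def searchAlgorithm : ExplorationAlgorithm := ⟨Program, Program.start, Program.move⟩

/-! ### Addresses and subtrees -/

namespace SearchTree

@[simp] theorem subtree?_nil (T : SearchTree) : T.subtree? [] = some T := by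
  cases T <;> rfl

theorem subtree?_append (T : SearchTree) (p q : List ℕ) :
    T.subtree? (p ++ q) = (T.subtree? p).bind fun u => u.subtree? q := by
  induction p generalizing T with
  | nil => simp
  | cons i p ih =>
    cases T with
    | leaf c => simp [subtree?]
    | inner n f =>
      by_cases h : i < n + 2
      · simp [subtree?, h, ih]
      · simp [subtree?, h]

theorem subtree?_append_of_eq {T u : SearchTree} {p : List ℕ} (h : T.subtree? p = some u)
    (q : List ℕ) : T.subtree? (p ++ q) = u.subtree? q := by
  rw [subtree?_append, h, Option.bind_some]

theorem subtree?_singleton (n : ℕ) (f : Fin (n + 2) → SearchTree) (j : Fin (n + 2)) :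
    (inner n f).subtree? [(j : ℕ)] = some (f j) := by
  simp [subtree?]

theorem subtree?_child {T : SearchTree} {p : List ℕ} {n : ℕ} {f : Fin (n + 2) → SearchTree}
    (h : T.subtree? p = some (inner n f)) (j : Fin (n + 2)) :
    T.subtree? (p ++ [(j : ℕ)]) = some (f j) := by
  rw [subtree?_append_of_eq h, subtree?_singleton]

theorem colorAt_eq_some {T : SearchTree} {p : List ℕ} {c : ℕ} :
    T.colorAt p = some c ↔ T.subtree? p = some (leaf c) := by
  unfold colorAt
  split <;> simp_all

end SearchTree

/-! ### The rank of a program -/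

namespace Program

open ExplorationAlgorithm SearchTree

/-- The expectation of `f` at the end of a random walk from `v` to a leaf, plus the expected number
of steps; `u` is the subtree at `v`. -/
noncomputable def walkRank (t : Fin 2)
    (f : List ℕ → ℕ → Finset (Fin 2 × List ℕ) → ℝ≥0∞) :
    SearchTree → List ℕ → Finset (Fin 2 × List ℕ) → ℝ≥0∞
  | .leaf c, v, E => f v c E
  | .inner n g, v, E => 2 + (∑ j : Fin (n + 2),
      walkRank t f (g j) (v ++ [(j : ℕ)]) (insert (t, v ++ [(j : ℕ)]) E)) / (n + 2 : ℕ)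

open Classical in
/-- The expected number of steps until a program halts, when the explored nodes are `E`; `⊤` if the
program may make a mistake or a void request. The value at the beginning of phase `k` is assumed to
be `Φ k`. -/
noncomputable def rank (T : Fin 2 → SearchTree) (Φ : ℕ → ℝ≥0∞) :
    Program → Finset (Fin 2 × List ℕ) → ℝ≥0∞
  | query t v i next, E =>
    match (T t).subtree? (v ++ [i]) with
    | some u => if (t, v) ∈ E then 1 + rank T Φ (next u.info) (insert (t, v ++ [i]) E) else ⊤
    | none => ⊤
  | draw n next, E => 1 + (∑ j, rank T Φ (next j) E) / (n + 1 : ℕ)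
  | walk t v n next, E =>
    match (T t).subtree? v with
    | some u => if (t, v) ∈ E ∧ u.info = .inner (n + 1) then
        walkRank t (fun p c => rank T Φ (next p c)) u v E else ⊤
    | none => ⊤
  | phase k roots, E =>
    if (∀ t, roots t = (T t).info) ∧ (∀ t, (t, []) ∈ E) then Φ k else ⊤
  | halt out, E => if CorrectOutput T E out then 0 else ⊤

variable {T : Fin 2 → SearchTree} {Φ : ℕ → ℝ≥0∞} {E : Finset (Fin 2 × List ℕ)}

theorem rank_query {t : Fin 2} {v : List ℕ} {i : ℕ} {u : SearchTree} (next : NodeInfo → Program)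
    (hE : (t, v) ∈ E) (hu : (T t).subtree? (v ++ [i]) = some u) :
    rank T Φ (query t v i next) E = 1 + rank T Φ (next u.info) (insert (t, v ++ [i]) E) := by
  simp [rank, hu, hE]

theorem rank_walk {t : Fin 2} {v : List ℕ} {n : ℕ} {f : Fin (n + 2) → SearchTree}
    (next : List ℕ → ℕ → Program) (hE : (t, v) ∈ E) (hu : (T t).subtree? v = some (inner n f)) :
    rank T Φ (walk t v (n + 1) next) E =
      walkRank t (fun p c => rank T Φ (next p c)) (inner n f) v E := by
  simp [rank, hu, hE, info]

theorem rank_descend {t : Fin 2} {v : List ℕ} {u : SearchTree} (next : List ℕ → ℕ → Program)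
    (hE : (t, v) ∈ E) (hu : (T t).subtree? v = some u) :
    rank T Φ (descend t v next u.info) E =
      walkRank t (fun p c => rank T Φ (next p c)) u v E := by
  cases u with
  | leaf c => rfl
  | inner n f => exact rank_walk next hE hu

/-- `rank` follows the execution by recursion on the program, so the decrease is built in except at
`phase`, where the recursion is cut off. There `hΦ` closes the loop. -/
theorem one_add_expect_step_le
    (hΦ : ∀ k roots, (∀ t, roots t = (T t).info) → (∀ t, (t, []) ∈ E) →
      1 + rank T Φ (phaseBody k roots) E ≤ Φ k)
    (P : Program) (hP : ¬ searchAlgorithm.Halted ⟨P, E⟩) :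
    1 + (searchAlgorithm.step T ⟨P, E⟩).expect (fun c => rank T Φ c.state c.explored)
      ≤ rank T Φ P E := by
  by_cases htop : rank T Φ P E = ⊤
  · rw [htop]
    exact le_top
  cases P with
  | query t v i next =>
    have hm : searchAlgorithm.move (query t v i next) =
      .query t v i fun o => o.elim (halt none) next := rfl
    simp only [step, hm]
    rw [rank] at htop ⊢
    cases hu : (T t).subtree? (v ++ [i]) with
    | none => simp [hu] at htop
    | some u =>
      simp only [hu] at htop ⊢
      split_ifs at htop ⊢ with h
      · rw [PMF.expect_pure]
        exact le_rfl
      · exact absurd rfl htop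
  | draw n next =>
    have hm : searchAlgorithm.move (draw n next) = .draw n next := rfl
    simp only [step, hm]
    rw [rank, PMF.expect_map, PMF.expect_uniform]
  | walk t v n next =>
    have hm : searchAlgorithm.move (walk t v n next) = .draw n fun j => query t v j fun info =>
      descend t (v ++ [(j : ℕ)]) next info := rfl
    simp only [step, hm]
    rw [rank] at htop ⊢
    cases hu : (T t).subtree? v with
    | none => simp [hu] at htop
    | some u =>
      simp only [hu] at htop ⊢
      split_ifs at htop ⊢ with h
      · cases u with
        | leaf c => simp [info] at h
        | inner m f =>
          obtain ⟨h1, h2⟩ := h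
          obtain rfl : m + 1 = n := by simpa [info] using h2
          rw [PMF.expect_map, PMF.expect_uniform]
          -- One unit for the request; with the unit for the draw it makes up the 2 per level in
          -- `walkRank`.
          have key j : rank T Φ (query t v (j : Fin (m + 2)) fun info =>
              descend t (v ++ [(j : ℕ)]) next info) E = 1 + walkRank t
                (fun p c => rank T Φ (next p c)) (f j) (v ++ [(j : ℕ)])
                (insert (t, v ++ [(j : ℕ)]) E) := by
            rw [rank_query _ h1 (subtree?_child hu j), rank_descend _ (by simp)
              (subtree?_child hu j)]
          simp only [key]
          rw [walkRank, Finset.sum_add_distrib, ENNReal.add_div, ← add_assoc]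
          simp only [Finset.sum_const, Finset.card_univ, Fintype.card_fin, nsmul_eq_mul, mul_one]
          rw [ENNReal.div_self (by simp) (by finiteness), one_add_one_eq_two]
      · exact absurd rfl htop
  | phase k roots =>
    have hm : searchAlgorithm.move (phase k roots) = .draw 0 fun _ => phaseBody k roots := rfl
    simp only [step, hm]
    rw [rank] at htop ⊢
    split_ifs at htop ⊢ with h
    · rw [PMF.expect_map, PMF.expect_uniform]
      simpa using hΦ k roots h.1 h.2
    · exact absurd rfl htop
  | halt out => exact absurd ⟨out, rfl⟩ hP

end Program

/-! ### Sizes, degrees and the frontier -/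

namespace SearchTree

theorem size_pos (u : SearchTree) : 0 < u.size := by
  cases u <;> simp [size]

theorem size_child_le {n : ℕ} (f : Fin (n + 2) → SearchTree) (j : Fin (n + 2)) :
    (f j).size ≤ (inner n f).size := by
  rw [size]
  exact (Finset.single_le_sum (f := fun i => (f i).size) (fun _ _ => Nat.zero_le _)
    (Finset.mem_univ j)).trans (Nat.le_add_left _ _)

theorem maxDegree_child_le {n : ℕ} (f : Fin (n + 2) → SearchTree) (j : Fin (n + 2)) :
    (f j).maxDegree ≤ (inner n f).maxDegree := by
  rw [maxDegree]
  exact (Finset.le_sup (f := fun i => (f i).maxDegree) (Finset.mem_univ j)).trans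
    (le_max_right _ _)

/-- `u'` is the subtree at the node with address `p`, and this is the first node on its branch at
which the weight, which starts as `m` at the root and is divided by the degree in each step,
vanishes, or it is a leaf. -/
inductive Frontier : ℕ → SearchTree → List ℕ → SearchTree → Prop
  | exhausted (u : SearchTree) : Frontier 0 u [] u
  | leaf (m c : ℕ) : Frontier m (.leaf c) [] (.leaf c)
  | inner {m n : ℕ} {f : Fin (n + 2) → SearchTree} (i : Fin (n + 2)) {p : List ℕ}
      {u' : SearchTree} : m ≠ 0 → Frontier (m / (n + 2)) (f i) p u' →
      Frontier m (.inner n f) (i :: p) u'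

theorem Frontier.subtree?_eq {m : ℕ} {u u' : SearchTree} {p : List ℕ} (h : Frontier m u p u') :
    u.subtree? p = some u' := by
  induction h with
  | exhausted u => simp
  | leaf m c => simp
  | inner i _ _ ih => simpa [subtree?] using ih

end SearchTree

/-- Jensen's inequality for the logarithm: the mean of the logarithms is at most the logarithm of
the mean, and dividing by `n + 2 ≥ 2` gains at least one binary digit. This makes twice the binary
logarithm of the size a potential for random walks. -/
theorem two_add_sum_logb_div_le {n : ℕ} (s : Fin (n + 2) → ℕ) (hs : ∀ j, 0 < s j) :
    2 + (∑ j, 2 * Real.logb 2 (s j)) / (n + 2 : ℕ) ≤ 2 * Real.logb 2 (1 + ∑ j, s j : ℕ) := by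
  have hn : (0 : ℝ) < (n + 2 : ℕ) := by positivity
  set S : ℕ := ∑ j, s j with hS
  have hSpos : 0 < S := Finset.sum_pos (fun j _ => hs j) Finset.univ_nonempty
  have hS' : (0 : ℝ) < S := by exact_mod_cast hSpos
  have hlog : ∑ j, Real.log (s j) ≤ (n + 2 : ℕ) * (Real.log S - Real.log (n + 2 : ℕ)) := by
    -- `log x ≤ x - 1` at the ratio of `s j` to the mean; the linear terms cancel in the sum over
    -- `j`.
    have key j : Real.log (s j) ≤
        (s j * (n + 2 : ℕ) / S - 1) + (Real.log S - Real.log (n + 2 : ℕ)) := by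
      have hj : (0 : ℝ) < s j := by exact_mod_cast hs j
      have := Real.log_le_sub_one_of_pos (show (0 : ℝ) < s j * (n + 2 : ℕ) / S by positivity)
      rw [Real.log_div (by positivity) hS'.ne', Real.log_mul hj.ne' hn.ne'] at this
      linarith
    refine (Finset.sum_le_sum fun j _ => key j).trans_eq ?_
    rw [Finset.sum_add_distrib, Finset.sum_sub_distrib, ← Finset.sum_div, ← Finset.sum_mul,
      ← Nat.cast_sum, ← hS]
    simp only [Finset.sum_const, Finset.card_univ, Fintype.card_fin, nsmul_eq_mul]
    field_simp
    ring
  have h2 : 0 < Real.log 2 := Real.log_pos one_lt_two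
  have hn2 : Real.log 2 ≤ Real.log (n + 2 : ℕ) :=
    Real.log_le_log two_pos (by push_cast; linarith [(Nat.cast_nonneg n : (0 : ℝ) ≤ n)])
  have hmono : Real.log S ≤ Real.log (1 + S : ℕ) :=
    Real.log_le_log hS' (by push_cast; linarith)
  simp only [Real.logb, ← Finset.mul_sum, ← Finset.sum_div]
  have h3 : (∑ j, Real.log (s j)) / (n + 2 : ℕ) ≤ Real.log (1 + S : ℕ) - Real.log 2 := by
    rw [div_le_iff₀ hn]
    nlinarith
  calc _ = 2 * ((Real.log 2 + (∑ j, Real.log (s j)) / (n + 2 : ℕ)) / Real.log 2) := by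
        field_simp
    _ ≤ _ := by gcongr; linarith

/-! ### Cost of the subroutines -/

namespace Program

open ExplorationAlgorithm SearchTree

variable {T : Fin 2 → SearchTree} {Φ : ℕ → ℝ≥0∞} {E : Finset (Fin 2 × List ℕ)} {t : Fin 2}
  {v : List ℕ} {u : SearchTree}

theorem walkRank_le (f : List ℕ → ℕ → Finset (Fin 2 × List ℕ) → ℝ≥0∞) (x : ℝ≥0∞)
    (hE : (t, v) ∈ E)
    (h : ∀ p c E', E ⊆ E' → (t, v ++ p) ∈ E' → u.subtree? p = some (leaf c) →
      f (v ++ p) c E' ≤ x) :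
    walkRank t f u v E ≤ ENNReal.ofReal (2 * Real.logb 2 u.size) + x := by
  induction u generalizing v E with
  | leaf c =>
    rw [walkRank]
    have := h [] c E subset_rfl (by simpa using hE) (by simp)
    simp only [List.append_nil] at this
    exact this.trans le_add_self
  | inner n g ih =>
    rw [walkRank]
    have key j : walkRank t f (g j) (v ++ [(j : ℕ)]) (insert (t, v ++ [(j : ℕ)]) E) ≤
        ENNReal.ofReal (2 * Real.logb 2 (g j).size) + x := by
      refine ih j (by simp) fun p c E' hE' hp hc => ?_
      have := h (j :: p) c E' ((Finset.subset_insert _ _).trans hE') (by simpa using hp)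
        (by simpa [subtree?] using hc)
      simpa using this
    have hlog j : 0 ≤ 2 * Real.logb 2 ((g j).size : ℝ) := by
      have : (1 : ℝ) ≤ (g j).size := by exact_mod_cast (g j).size_pos
      have := Real.logb_nonneg one_lt_two this
      positivity
    calc _ ≤ 2 + (∑ j, (ENNReal.ofReal (2 * Real.logb 2 (g j).size) + x)) / (n + 2 : ℕ) := by
          gcongr with j
          exact key j
      _ = ENNReal.ofReal (2 + (∑ j, 2 * Real.logb 2 (g j).size) / (n + 2 : ℕ)) + x := by
          rw [ENNReal.ofReal_add zero_le_two
            (div_nonneg (Finset.sum_nonneg fun j _ => hlog j) (Nat.cast_nonneg _)),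
            ENNReal.ofReal_div_of_pos (by positivity), ENNReal.ofReal_sum_of_nonneg
            (fun j _ => hlog j), ENNReal.ofReal_natCast, Finset.sum_add_distrib, ENNReal.add_div]
          simp only [Finset.sum_const, Finset.card_univ, Fintype.card_fin, nsmul_eq_mul]
          rw [ENNReal.mul_div_right_comm, ENNReal.div_self (by simp) (by finiteness), one_mul]
          simp [add_assoc]
      _ ≤ _ := by
          gcongr
          exact two_add_sum_logb_div_le _ fun j => (g j).size_pos

/-- Every entry of `L` is an explored leaf of tree number `t` together with its colour. -/
def FoundLeaves (T : Fin 2 → SearchTree) (t : Fin 2) (E : Finset (Fin 2 × List ℕ))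
    (L : List (List ℕ × ℕ)) : Prop :=
  ∀ y ∈ L, (t, y.1) ∈ E ∧ (T t).subtree? y.1 = some (leaf y.2)

theorem FoundLeaves.mono {L : List (List ℕ × ℕ)} (h : FoundLeaves T t E L)
    {E' : Finset (Fin 2 × List ℕ)} (hE : E ⊆ E') : FoundLeaves T t E' L :=
  fun y hy => ⟨hE (h y hy).1, (h y hy).2⟩

theorem FoundLeaves.append {L L' : List (List ℕ × ℕ)} (h : FoundLeaves T t E L)
    (h' : FoundLeaves T t E L') : FoundLeaves T t E (L ++ L') :=
  fun y hy => (List.mem_append.1 hy).elim (h y) (h' y)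

theorem foundLeaves_singleton {c : ℕ} (hE : (t, v) ∈ E)
    (hu : (T t).subtree? v = some (leaf c)) : FoundLeaves T t E [(v, c)] := by
  intro y hy
  obtain rfl := List.mem_singleton.1 hy
  exact ⟨hE, hu⟩

theorem foundLeaves_leafRecord (hE : (t, v) ∈ E) (hu : (T t).subtree? v = some u) :
    FoundLeaves T t E (leafRecord v u.info) := by
  cases u with
  | leaf c => exact foundLeaves_singleton hE hu
  | inner n f => simp [FoundLeaves, info, leafRecord]

/-- The bound on the continuation is affine in the number of vertices below the node reached, so
averaging needs only the probability of reaching each node. A leaf has nothing below it, hence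
contributes nothing to the `β` term even if it is reached with large probability. -/
theorem rank_walkToFrontier_le {m : ℕ} (next : List ℕ → NodeInfo → Program) (a β : ℝ≥0∞)
    (hE : (t, v) ∈ E) (hu : (T t).subtree? v = some u)
    (h : ∀ p u' E', E ⊆ E' → (t, v ++ p) ∈ E' → Frontier m u p u' →
      rank T Φ (next (v ++ p) u'.info) E' ≤ a + β * (u'.size - 1 : ℕ)) :
    rank T Φ (walkToFrontier t v m u.info next) E ≤
      2 * m + a + β * (u.size - 1 : ℕ) / (m + 1 : ℕ) := by
  induction m using Nat.strong_induction_on generalizing u v E with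
  | _ m ih =>
    cases u with
    | leaf c =>
      rw [info, walkToFrontier]
      have := h [] _ E subset_rfl (by simpa using hE) (.leaf m c)
      simp only [List.append_nil] at this
      refine this.trans ?_
      simp [size, add_comm]
    | inner n f =>
      rw [info, walkToFrontier]
      by_cases hm : m = 0
      · subst hm
        have := h [] _ E subset_rfl (by simpa using hE) (.exhausted _)
        simpa [info] using this
      · simp only [hm, dite_false, Nat.add_sub_cancel]
        have hlt : m / (n + 2) < m := Nat.div_lt_self (Nat.pos_of_ne_zero hm) (by omega)
        have key (j : Fin (n + 2)) : rank T Φ (query t v j fun info =>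
            walkToFrontier t (v ++ [(j : ℕ)]) (m / (n + 2)) info next) E ≤
            1 + (2 * (m / (n + 2) : ℕ) + a
              + β * ((f j).size - 1 : ℕ) / (m / (n + 2) + 1 : ℕ)) := by
          rw [rank_query _ hE (subtree?_child hu j)]
          gcongr
          refine ih _ hlt (by simp) (subtree?_child hu j) fun p u' E' hE' hp hfr => ?_
          have := h (j :: p) u' E' ((Finset.subset_insert _ _).trans hE') (by simpa using hp)
            (.inner j hm hfr)
          simpa using this
        have hsum : (∑ j, (((f j).size - 1 : ℕ) : ℝ≥0∞)) ≤ ((inner n f).size - 1 : ℕ) := by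
          rw [size, Nat.add_sub_cancel_left]
          exact_mod_cast Finset.sum_le_sum fun j _ => Nat.sub_le (f j).size 1
        -- By this inequality the product of the degrees down to a node of vanishing weight is at
        -- least `m + 1`.
        have hdiv : m + 1 ≤ (m / (n + 2) + 1) * (n + 2) := by
          have := Nat.lt_mul_div_succ m (show 0 < n + 2 by omega)
          rw [mul_comm]
          omega
        rw [rank]
        calc _ ≤ 1 + (∑ j : Fin (n + 2), (1 + (2 * (m / (n + 2) : ℕ) + a
              + β * ((f j).size - 1 : ℕ) / (m / (n + 2) + 1 : ℕ)))) / (n + 1 + 1 : ℕ) :=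
              add_le_add le_rfl (ENNReal.div_le_div_right (Finset.sum_le_sum fun j _ => key j) _)
          _ = 1 + (1 + (2 * (m / (n + 2) : ℕ) + a)) + β * (∑ j, (((f j).size - 1 : ℕ) : ℝ≥0∞))
                / ((m / (n + 2) + 1) * (n + 2) : ℕ) := by
              simp only [← add_assoc, Finset.sum_add_distrib, ENNReal.add_div,
                Finset.sum_const, Finset.card_univ, Fintype.card_fin, nsmul_eq_mul]
              have h0 : ((n + 2 : ℕ) : ℝ≥0∞) ≠ 0 := by simp
              have h1 : ((n + 2 : ℕ) : ℝ≥0∞) ≠ ⊤ := by finiteness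
              simp only [ENNReal.mul_div_right_comm (a := ((n + 2 : ℕ) : ℝ≥0∞)),
                ENNReal.div_self h0 h1, one_mul]
              congr 1
              simp only [div_eq_mul_inv, ← Finset.sum_mul, ← Finset.mul_sum]
              rw [Nat.cast_mul, ENNReal.mul_inv (by simp) (by simp), mul_assoc]
          _ ≤ 1 + (1 + (2 * (m / (n + 2) : ℕ) + a)) + β * ((inner n f).size - 1 : ℕ)
                / (m + 1 : ℕ) := by gcongr
          _ ≤ _ := by
              refine add_le_add ?_ le_rfl
              rw [show (1 : ℝ≥0∞) + (1 + (2 * (m / (n + 2) : ℕ) + a))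
                = ((1 + 1 + 2 * (m / (n + 2)) : ℕ) : ℝ≥0∞) + a by push_cast; ring]
              gcongr
              have : ((1 + 1 + 2 * (m / (n + 2)) : ℕ) : ℝ≥0∞) ≤ ((2 * m : ℕ) : ℝ≥0∞) := by
                gcongr
                omega
              simpa using this

/-- A bound for the expected cost of exploring a frontier of weight `m`. -/
noncomputable def exploreCost (D : ℕ) (w : ℝ≥0∞) (m : ℕ) : ℝ≥0∞ :=
  if m = 0 then w else (D * (1 + w) + 2) * m - 2

/-- The subtracted 2 in `exploreCost` pays for the requests: for `q = m / (n + 2) ≥ 1` and `X = D *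
(1 + w) + 2`, the left side is `(n + 2) * (X * q - 1)`, which is at most `X * m - 2` because `n + 2
≥ 2`. -/
theorem exploreCost_children_le {D m n : ℕ} (w : ℝ≥0∞) (hm : m ≠ 0) (hD : n + 2 ≤ D) :
    ((n + 2 : ℕ) : ℝ≥0∞) * (1 + exploreCost D w (m / (n + 2))) ≤ exploreCost D w m := by
  rw [exploreCost, exploreCost, if_neg hm]
  refine ENNReal.le_sub_of_add_le_right (by simp) ?_
  have h1 : (1 : ℝ≥0∞) ≤ m := by exact_mod_cast Nat.one_le_iff_ne_zero.2 hm
  split_ifs with h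
  · calc _ ≤ (D : ℝ≥0∞) * (1 + w) + 2 := by gcongr
      _ ≤ _ := le_mul_of_one_le_right' h1
  · set X : ℝ≥0∞ := D * (1 + w) + 2
    have h2 : 2 ≤ X * (m / (n + 2) : ℕ) := by
      have : (1 : ℝ≥0∞) ≤ (m / (n + 2) : ℕ) := by exact_mod_cast Nat.one_le_iff_ne_zero.2 h
      exact (le_add_self : 2 ≤ X).trans (le_mul_of_one_le_right' this)
    obtain ⟨z, hz⟩ := exists_add_of_le h2
    rw [hz, ENNReal.add_sub_cancel_left (by simp)]
    calc (n + 2 : ℕ) * (1 + z) + 2 ≤ ((n + 2 : ℕ) : ℝ≥0∞) * (1 + z) + (n + 2 : ℕ) := by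
          gcongr
          simp
      _ = (X * (m / (n + 2) : ℕ)) * (n + 2 : ℕ) := by rw [hz]; ring
      _ = X * (m / (n + 2) * (n + 2) : ℕ) := by push_cast; ring
      _ ≤ _ := by
          gcongr
          exact Nat.div_mul_le_self _ _

theorem rank_exploreFrontier_le {m D : ℕ} (next : List (List ℕ × ℕ) → Program) (x w : ℝ≥0∞)
    (hE : (t, v) ∈ E) (hu : (T t).subtree? v = some u) (hD : u.maxDegree ≤ D)
    (hw : ENNReal.ofReal (2 * Real.logb 2 u.size) ≤ w)
    (h : ∀ L E', E ⊆ E' → FoundLeaves T t E' L →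
      (∀ p u', Frontier m u p u' →
        ∃ q c, u'.subtree? q = some (leaf c) ∧ (v ++ p ++ q, c) ∈ L) →
      rank T Φ (next L) E' ≤ x) :
    rank T Φ (exploreFrontier t v m u.info next) E ≤ exploreCost D w m + x := by
  induction m using Nat.strong_induction_on generalizing u v E next x with
  | _ m ih =>
    cases u with
    | leaf c =>
      rw [info, exploreFrontier]
      refine (h _ E subset_rfl (foundLeaves_singleton hE hu) fun p u' hfr => ?_).trans le_add_self
      refine ⟨[], c, ?_⟩
      cases hfr <;> simp
    | inner n f =>
      rw [info, exploreFrontier]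
      by_cases hm : m = 0
      · subst hm
        simp only [dite_true]
        rw [show n + 2 - 1 = n + 1 from rfl, rank_walk _ hE hu, exploreCost, if_pos rfl]
        refine (walkRank_le _ x hE fun p c E' hE' hp hc => ?_).trans (by gcongr)
        refine h _ E' hE' (foundLeaves_singleton hp ?_) fun p' u' hfr => ?_
        · rw [subtree?_append_of_eq hu, hc]
        · cases hfr with
          | exhausted => exact ⟨p, c, hc, by simp⟩
          | inner _ h0 => exact absurd rfl h0
      · simp only [hm, dite_false, Nat.add_sub_cancel]
        have hlt : m / (n + 2) < m := Nat.div_lt_self (Nat.pos_of_ne_zero hm) (by omega)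
        have hD' : n + 2 ≤ D := (le_max_left _ _).trans hD
        set y := exploreCost D w (m / (n + 2))
        -- Generalized to the children `l` still to be visited and the leaves already found, for
        -- induction along the fold.
        have key (l : List ℕ) (hl : ∀ i ∈ l, i < n + 2) (found : List (List ℕ × ℕ))
            (E₁ : Finset (Fin 2 × List ℕ)) (hE₁ : E ⊆ E₁) (hfound : FoundLeaves T t E₁ found)
            (hnext : ∀ L E', E₁ ⊆ E' → FoundLeaves T t E' L → found ⊆ L →
              (∀ j : Fin (n + 2), (j : ℕ) ∈ l → ∀ p u', Frontier (m / (n + 2)) (f j) p u' →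
                ∃ q c, u'.subtree? q = some (leaf c) ∧ (v ++ [(j : ℕ)] ++ p ++ q, c) ∈ L) →
              rank T Φ (next L) E' ≤ x) :
            rank T Φ (l.foldr (fun i rest found => query t v i fun info =>
              exploreFrontier t (v ++ [i]) (m / (n + 2)) info fun more => rest (found ++ more))
              next found) E₁ ≤ l.length * (1 + y) + x := by
          induction l generalizing found E₁ with
          | nil =>
            simp only [List.foldr_nil]
            exact (hnext _ _ subset_rfl hfound (List.Subset.refl _) (by simp)).trans le_add_self
          | cons i l ihl =>
            obtain ⟨j, rfl⟩ : ∃ j : Fin (n + 2), (j : ℕ) = i := ⟨⟨i, hl i (by simp)⟩, rfl⟩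
            rw [List.foldr_cons, rank_query _ (hE₁ hE) (subtree?_child hu j)]
            calc _ ≤ 1 + (y + (l.length * (1 + y) + x)) := by
                  gcongr
                  refine ih _ hlt _ _ (by simp) (subtree?_child hu j)
                    ((maxDegree_child_le f j).trans hD) (le_trans ?_ hw) ?_
                  · gcongr
                    · norm_num
                    · exact_mod_cast (f j).size_pos
                    · exact size_child_le f j
                  · intro L E' hE' hL hcov
                    have hE₁' := (Finset.subset_insert _ _).trans hE'
                    refine ihl (fun i hi => hl i (by simp [hi])) _ _ (hE₁.trans hE₁')
                      ((hfound.mono hE₁').append hL) fun L' E'' hE'' hL' hsub hcov' => ?_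
                    refine hnext L' E'' (hE₁'.trans hE'') hL'
                      (fun a ha => hsub (List.mem_append_left _ ha)) fun j' hj' p u' hfr => ?_
                    rcases List.mem_cons.1 hj' with hj' | hj'
                    · obtain rfl := Fin.ext hj'
                      obtain ⟨q, c, hq, hmem⟩ := hcov p u' hfr
                      exact ⟨q, c, hq, hsub (List.mem_append_right _ hmem)⟩
                    · exact hcov' j' hj' p u' hfr
              _ = _ := by
                  rw [List.length_cons]
                  push_cast
                  ring
        refine (key (List.range (n + 2)) (by simp) [] E subset_rfl (by simp [FoundLeaves]) ?_).trans
          ?_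
        · intro L E' hE' hL _ hcov
          refine h L E' hE' hL fun p u' hfr => ?_
          cases hfr with
          | exhausted => exact absurd rfl hm
          | inner i _ hfr =>
            obtain ⟨q, c, hq, hmem⟩ := hcov i (by simp) _ _ hfr
            exact ⟨q, c, hq, by simpa using hmem⟩
        · rw [List.length_range]
          gcongr
          exact exploreCost_children_le w hm hD'

/-- The number of nodes whose exploration is pending: the requested nodes and everything below. -/
def pendingSize (S : SearchTree) (pending : List (List ℕ × ℕ)) : ℕ :=
  (pending.map fun y => (S.subtree? (y.1 ++ [y.2])).elim 0 size).sum

theorem pendingSize_childRequests {S : SearchTree} (hu : S.subtree? v = some u) :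
    pendingSize S (childRequests v u.info) = u.size - 1 := by
  cases u with
  | leaf c => simp [pendingSize, childRequests, info, size]
  | inner n f =>
    simp only [pendingSize, childRequests, info, List.map_map, size, Nat.add_sub_cancel_left]
    rw [← List.sum_ofFn, List.ofFn_eq_map, ← List.map_coe_finRange_eq_range, List.map_map]
    congr 1
    refine List.map_congr_left fun j _ => ?_
    simp [subtree?_child hu j]

theorem mem_of_leafRecord_of_childRequests {S : SearchTree} (hu : S.subtree? v = some u)
    {L : List (List ℕ × ℕ)} (hL : leafRecord v u.info ⊆ L)
    (hcov : ∀ y ∈ childRequests v u.info, ∀ q c,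
      S.subtree? (y.1 ++ [y.2] ++ q) = some (leaf c) → (y.1 ++ [y.2] ++ q, c) ∈ L)
    {q : List ℕ} {c : ℕ} (hq : S.subtree? (v ++ q) = some (leaf c)) : (v ++ q, c) ∈ L := by
  rw [subtree?_append_of_eq hu] at hq
  cases q with
  | nil =>
    obtain rfl : u = leaf c := by simpa using hq
    exact hL (by simp [leafRecord, info])
  | cons i q =>
    cases u with
    | leaf c' => simp [subtree?] at hq
    | inner n f =>
      have hi : i < n + 2 := by
        by_contra hi
        simp [subtree?, hi] at hq
      have := hcov (v, i) (by simp [childRequests, info, hi]) q c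
        (by simpa [subtree?_append_of_eq hu] using hq)
      simpa using this

/-- The requests in `pending` are legitimate. -/
def ValidRequests (T : Fin 2 → SearchTree) (t : Fin 2) (E : Finset (Fin 2 × List ℕ))
    (pending : List (List ℕ × ℕ)) : Prop :=
  ∀ y ∈ pending, (t, y.1) ∈ E ∧ ∃ u, (T t).subtree? (y.1 ++ [y.2]) = some u

theorem validRequests_childRequests (hE : (t, v) ∈ E) (hu : (T t).subtree? v = some u) :
    ValidRequests T t E (childRequests v u.info) := by
  cases u with
  | leaf c => simp [ValidRequests, childRequests, info]
  | inner n f =>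
    intro y hy
    obtain ⟨i, hi, rfl⟩ := List.mem_map.1 hy
    exact ⟨hE, f ⟨i, List.mem_range.1 hi⟩, subtree?_child hu ⟨i, List.mem_range.1 hi⟩⟩

/-- Each request replaces a pending node by its children, so `pendingSize` and the budget both drop
by exactly one. Thus `fail` is reached only if the budget was too small from the start. -/
theorem rank_depthFirst_le {next : List (List ℕ × ℕ) → Program} {fail : Program} {B : ℕ}
    {pending found : List (List ℕ × ℕ)} {x : ℝ≥0∞}
    (hp : ValidRequests T t E pending) (hfound : FoundLeaves T t E found)
    (hnext : ∀ L E', E ⊆ E' → FoundLeaves T t E' L → found ⊆ L →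
      (∀ y ∈ pending, ∀ q c, (T t).subtree? (y.1 ++ [y.2] ++ q) = some (leaf c) →
        (y.1 ++ [y.2] ++ q, c) ∈ L) → rank T Φ (next L) E' ≤ x)
    (hfail : B < pendingSize (T t) pending → ∀ E', E ⊆ E' → rank T Φ fail E' ≤ x) :
    rank T Φ (depthFirst t next fail B pending found) E ≤ B + x := by
  induction B generalizing pending found E with
  | zero =>
    cases pending with
    | nil =>
      simpa [depthFirst] using hnext found E subset_rfl hfound (List.Subset.refl _) (by simp)
    | cons y pending =>
      obtain ⟨-, u, hu⟩ := hp y (by simp)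
      simp only [depthFirst, Nat.cast_zero, zero_add]
      refine hfail ?_ E subset_rfl
      have := u.size_pos
      simp only [pendingSize, List.map_cons, List.sum_cons, hu, Option.elim_some]
      omega
  | succ B ih =>
    cases pending with
    | nil =>
      rw [depthFirst]
      exact (hnext found E subset_rfl hfound (List.Subset.refl _) (by simp)).trans le_add_self
    | cons y pending =>
      obtain ⟨v, i⟩ := y
      obtain ⟨hE, u, hu⟩ := hp (v, i) (by simp)
      dsimp only at hE hu
      have hmem : (t, v ++ [i]) ∈ insert (t, v ++ [i]) E := by simp
      have hsub := Finset.subset_insert (t, v ++ [i]) E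
      rw [depthFirst, rank_query _ hE hu, Nat.cast_succ, add_comm (B : ℝ≥0∞), add_assoc]
      gcongr
      refine ih ?_ ?_ ?_ ?_
      · intro y hy
        rcases List.mem_append.1 hy with hy | hy
        · exact validRequests_childRequests hmem hu y hy
        · obtain ⟨h1, h2⟩ := hp y (by simp [hy])
          exact ⟨hsub h1, h2⟩
      · exact (foundLeaves_leafRecord hmem hu).append (hfound.mono hsub)
      · intro L E' hE' hL hfL hcov
        refine hnext L E' (hsub.trans hE') hL (fun a ha => hfL (List.mem_append_right _ ha))
          fun y hy q c hq => ?_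
        rcases List.mem_cons.1 hy with rfl | hy
        · exact mem_of_leafRecord_of_childRequests hu (fun a ha => hfL (List.mem_append_left _ ha))
            (fun y hy => hcov y (List.mem_append_left _ hy)) hq
        · exact hcov y (List.mem_append_right _ hy) q c hq
      · intro hlt E' hE'
        refine hfail ?_ E' (hsub.trans hE')
        have h1 := u.size_pos
        have h2 := pendingSize_childRequests hu
        simp only [pendingSize, List.map_append, List.sum_append, List.map_cons, List.sum_cons, hu,
          Option.elim_some] at hlt h2 ⊢
        omega

end Program

/-! ### Isomorphic trees are bisimilar -/

namespace SearchTree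

/-- A bisimulation that respects degrees and colours. -/
inductive Similar : SearchTree → SearchTree → Prop
  | leaf (c : ℕ) : Similar (.leaf c) (.leaf c)
  | inner {n : ℕ} {f g : Fin (n + 2) → SearchTree} (σ τ : Fin (n + 2) → Fin (n + 2)) :
      (∀ i, Similar (f i) (g (σ i))) → (∀ j, Similar (f (τ j)) (g j)) →
      Similar (.inner n f) (.inner n g)

/-- The weights depend only on the degrees along a branch, and `σ` transports branches without
changing these. -/
theorem Similar.exists_frontier {m : ℕ} {S T S' : SearchTree} {p : List ℕ}
    (hfr : Frontier m S p S') (h : Similar S T) :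
    ∃ q T', Frontier m T q T' ∧ Similar S' T' := by
  induction hfr generalizing T with
  | exhausted u => exact ⟨[], T, .exhausted T, h⟩
  | leaf m c =>
    cases h
    exact ⟨[], _, .leaf m c, .leaf c⟩
  | inner i hm _ ih =>
    cases h with
    | inner σ τ hσ hτ =>
      obtain ⟨q, T', hq, hT'⟩ := ih (hσ i)
      exact ⟨_, T', .inner (σ i) hm hq, hT'⟩

theorem Similar.exists_leaf {S T : SearchTree} (h : Similar S T) {q : List ℕ} {c : ℕ}
    (hq : T.subtree? q = some (.leaf c)) : ∃ p, S.subtree? p = some (.leaf c) := by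
  induction h generalizing q with
  | leaf c' =>
    cases q with
    | nil => exact ⟨[], by simpa using hq⟩
    | cons i q => simp [subtree?] at hq
  | @inner n f g σ τ _ _ _ ih =>
    cases q with
    | nil => simp at hq
    | cons j q =>
      by_cases hj : j < n + 2
      · obtain ⟨p, hp⟩ := ih ⟨j, hj⟩ (by simpa [subtree?, hj] using hq)
        exact ⟨τ ⟨j, hj⟩ :: p, by simpa [subtree?] using hp⟩
      · simp [subtree?, hj] at hq

theorem subtree?_append_singleton {T u w : SearchTree} {p : List ℕ} {i : ℕ}
    (hu : T.subtree? p = some u) (hw : T.subtree? (p ++ [i]) = some w) :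
    ∃ n f, ∃ j : Fin (n + 2), (j : ℕ) = i ∧ u = inner n f := by
  rw [subtree?_append_of_eq hu] at hw
  cases u with
  | leaf c => simp [subtree?] at hw
  | inner n f =>
    have hi : i < n + 2 := by
      by_contra hi
      simp [subtree?, hi] at hw
    exact ⟨n, f, ⟨i, hi⟩, rfl, rfl⟩

theorem IsColorIso.similar_subtree {S T : SearchTree} {φ : S.Vert ≃ T.Vert} (hφ : IsColorIso φ)
    (u : SearchTree) (v : S.Vert) (hu : S.subtree? v.1 = some u) :
    ∃ w, T.subtree? (φ v).1 = some w ∧ Similar u w := by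
  induction u generalizing v with
  | leaf c =>
    exact ⟨_, colorAt_eq_some.1 (hφ.color v c (colorAt_eq_some.2 hu)), .leaf c⟩
  | inner n f ih =>
    obtain ⟨w, hw⟩ := Option.isSome_iff_exists.1 (φ v).2
    have hchild i : (S.subtree? (v.1 ++ [((i : Fin (n + 2)) : ℕ)])).isSome := by
      rw [subtree?_child hu]
      rfl
    have hσ i : ∃ k, (φ ⟨_, hchild i⟩).1 = (φ v).1 ++ [k] := (hφ.child _ _).1 ⟨i, rfl⟩
    choose σ hσ using hσ
    have hw' i : ∃ w', T.subtree? ((φ v).1 ++ [σ i]) = some w' :=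
      Option.isSome_iff_exists.1 (by rw [← hσ]; exact (φ _).2)
    obtain ⟨n', g, -, -, rfl⟩ := subtree?_append_singleton hw (hw' 0).choose_spec
    have hlt i : σ i < n' + 2 := by
      obtain ⟨m, h, j, hj, he⟩ := subtree?_append_singleton hw (hw' i).choose_spec
      cases he
      omega
    have hchild' j : (T.subtree? ((φ v).1 ++ [((j : Fin (n' + 2)) : ℕ)])).isSome := by
      rw [subtree?_child hw]
      rfl
    -- As `φ` is surjective and reflects the child relation, every child of `φ v` is the image of a
    -- child of `v`.
    have hτ j : ∃ i : Fin (n + 2), φ ⟨_, hchild i⟩ = ⟨_, hchild' j⟩ := by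
      obtain ⟨x, hx⟩ := φ.surjective ⟨_, hchild' j⟩
      have hxv : IsChild x v := by
        rw [hφ.child, hx]
        exact ⟨j, rfl⟩
      obtain ⟨i, hi⟩ := hxv
      obtain ⟨w', hw'⟩ := Option.isSome_iff_exists.1 x.2
      rw [hi] at hw'
      obtain ⟨m, h, i', hi', he⟩ := subtree?_append_singleton hu hw'
      cases he
      refine ⟨i', ?_⟩
      rw [← hx]
      congr 1
      exact Subtype.ext ((congrArg (fun a => v.1 ++ [a]) hi').trans hi.symm)
    choose τ hτ using hτ
    have hτ' j : σ (τ j) = j := by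
      have := congrArg Subtype.val (hτ j)
      rw [hσ] at this
      simpa using this
    -- Both `σ` and its right inverse `τ` are injective, so the degrees agree.
    have hn : n' = n := by
      have h1 : Function.Injective fun i => (⟨σ i, hlt i⟩ : Fin (n' + 2)) := by
        intro i i' h
        have h2 : φ ⟨_, hchild i⟩ = φ ⟨_, hchild i'⟩ :=
          Subtype.ext (by rw [hσ, hσ, Fin.mk.inj h])
        have h3 := congrArg Subtype.val (φ.injective h2)
        exact Fin.ext (by simpa using h3)
      have h2 : Function.Injective τ := fun j j' h => Fin.ext (by rw [← hτ', ← hτ', h])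
      have h3 := Fintype.card_le_of_injective _ h1
      have h4 := Fintype.card_le_of_injective _ h2
      simp only [Fintype.card_fin] at h3 h4
      omega
    subst hn
    have hsim i : Similar (f i) (g ⟨σ i, hlt i⟩) := by
      obtain ⟨w', hw', hs⟩ := ih i ⟨_, hchild i⟩ (subtree?_child hu i)
      rw [hσ] at hw'
      have := subtree?_child hw ⟨σ i, hlt i⟩
      dsimp only at this
      rw [this] at hw'
      cases hw'
      exact hs
    refine ⟨_, hw, .inner _ τ hsim fun j => ?_⟩
    have := hsim (τ j)
    simpa [hτ'] using this

theorem IsColorIso.similar {S T : SearchTree} {φ : S.Vert ≃ T.Vert} (hφ : IsColorIso φ) :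
    Similar S T := by
  obtain ⟨w, hw, hs⟩ := hφ.similar_subtree S ⟨[], by simp⟩ (by simp)
  -- Otherwise the image of the root has a parent, whose preimage would have the root as a child.
  have hroot : (φ ⟨[], by simp⟩).1 = [] := by
    by_contra hne
    obtain ⟨p, i, hp⟩ : ∃ p i, (φ ⟨[], by simp⟩).1 = p ++ [i] :=
      ⟨_, _, (List.dropLast_append_getLast hne).symm⟩
    have hpv : (T.subtree? p).isSome := by
      have := (φ ⟨[], by simp⟩).2
      rw [hp, subtree?_append] at this
      exact Option.isSome_of_isSome_bind this
    obtain ⟨x, hx⟩ := φ.surjective ⟨p, hpv⟩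
    have : IsChild ⟨[], by simp⟩ x := (hφ.child _ _).2 ⟨i, by rw [hx]; exact hp⟩
    obtain ⟨j, hj⟩ := this
    simp at hj
  rw [hroot, subtree?_nil] at hw
  cases hw
  exact hs

theorem Invariant.similar {S T : SearchTree} (h : S.Invariant T) {p q : List ℕ} {c : ℕ}
    (hp : S.subtree? p = some (leaf c)) (hq : T.subtree? q = some (leaf c)) : Similar S T := by
  obtain ⟨φ, hφ, -⟩ := h ⟨p, by simp [hp]⟩ ⟨q, by simp [hq]⟩ c (colorAt_eq_some.2 hp)
    (colorAt_eq_some.2 hq)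
  exact hφ.similar

end SearchTree

/-! ### Attempts and phases -/

namespace Program

open ExplorationAlgorithm SearchTree

variable {T : Fin 2 → SearchTree} {Φ : ℕ → ℝ≥0∞} {E : Finset (Fin 2 × List ℕ)} {t : Fin 2}

theorem correctOutput_matchLeaves {L L' : List (List ℕ × ℕ)} (hL : FoundLeaves T t E L)
    (hL' : FoundLeaves T (1 - t) E L')
    (h : ∀ p q c, (T t).subtree? p = some (leaf c) → (T (1 - t)).subtree? q = some (leaf c) →
      ∃ y ∈ L, ∃ y' ∈ L', y.2 = y'.2) :
    CorrectOutput T E (matchLeaves t L L') := by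
  unfold matchLeaves
  cases hf : (L.product L').find? fun x => x.1.2 == x.2.2 with
  | none =>
    rintro ⟨l₀, l₁, c, h₀, h₁⟩
    rw [colorAt_eq_some] at h₀ h₁
    obtain ⟨y, hy, y', hy', he⟩ : ∃ y ∈ L, ∃ y' ∈ L', y.2 = y'.2 := by
      fin_cases t
      · exact h l₀ l₁ c h₀ h₁
      · exact h l₁ l₀ c h₁ h₀
    have := List.find?_eq_none.1 hf (y, y') (List.mem_product.2 ⟨hy, hy'⟩)
    simp [he] at this
  | some x =>
    have he : x.1.2 = x.2.2 := by simpa using List.find?_some hf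
    obtain ⟨h1, h2⟩ := List.mem_product.1 (List.mem_of_find?_eq_some hf)
    obtain ⟨hE, hu⟩ := hL _ h1
    obtain ⟨hE', hu'⟩ := hL' _ h2
    fin_cases t
    · exact ⟨hE, hE', x.1.2, colorAt_eq_some.2 hu, colorAt_eq_some.2 (he ▸ hu')⟩
    · exact ⟨hE', hE, x.1.2, colorAt_eq_some.2 (he ▸ hu'), colorAt_eq_some.2 hu⟩

section

variable {k D : ℕ} {roots : Fin 2 → NodeInfo} {w b : ℝ≥0∞} {fail : Program}

/-- Exceeding the budget adds the cost `b` of `fail`. An affine function of the size that dominates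
both outcomes can be averaged over the walk: `β = 0` gives the worst case, `β = b / (4 * 2 ^ k)`
gives Markov's inequality. -/
theorem rank_attempt_le_add_mul (a β : ℝ≥0∞) (hinv : (T t).Invariant (T (1 - t)))
    (hroots : ∀ s, roots s = (T s).info) (hE : ∀ s, (s, []) ∈ E)
    (hD : (T (1 - t)).maxDegree ≤ D)
    (hw : ENNReal.ofReal (2 * Real.logb 2 (T (1 - t)).size) ≤ w)
    (hfail : ∀ E', E ⊆ E' → rank T Φ fail E' ≤ b)
    (ha : 4 * 2 ^ k + exploreCost D w (2 ^ k) ≤ a)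
    (hb : ∀ s : ℕ, 4 * 2 ^ k < s → 4 * 2 ^ k + exploreCost D w (2 ^ k) + b ≤ a + β * s) :
    rank T Φ (attempt t roots k fail) E ≤
      2 * 2 ^ k + a + β * ((T t).size - 1 : ℕ) / (2 ^ k + 1) := by
  rw [attempt, hroots t]
  have := rank_walkToFrontier_le (T := T) (Φ := Φ) (m := 2 ^ k)
    (fun v info => depthFirst t (fun L => exploreFrontier (1 - t) [] (2 ^ k) (roots (1 - t))
      fun L' => halt (matchLeaves t L L')) fail (4 * 2 ^ k) (childRequests v info)
      (leafRecord v info)) a β (hE t) (subtree?_nil _) fun p u E₁ hE₁ hp hfr => ?_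
  · simpa using this
  simp only [List.nil_append] at hp ⊢
  have hu := hfr.subtree?_eq
  set cost := exploreCost D w (2 ^ k)
  set x : ℝ≥0∞ := if 4 * 2 ^ k < u.size - 1 then cost + b else cost with hx
  have hx1 : cost ≤ x := by
    rw [hx]
    split_ifs
    · exact le_self_add
    · exact le_rfl
  refine (rank_depthFirst_le (x := x) (validRequests_childRequests hp hu)
    (foundLeaves_leafRecord hp hu) ?_ ?_).trans ?_
  · intro L E₂ hE₂ hL hrec hcov
    refine le_trans ?_ hx1
    rw [hroots]
    refine (rank_exploreFrontier_le _ 0 w (hE₂ (hE₁ (hE _))) (subtree?_nil _) hD hw ?_).trans_eq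
      (add_zero _)
    intro L' E₃ hE₃ hL' hcov'
    rw [rank, if_pos]
    refine correctOutput_matchLeaves (hL.mono hE₃) hL' fun l l' c hl hl' => ?_
    -- The frontier node of the other tree corresponding to the searched one: the leaf sampled below
    -- it has a color that also occurs in the fully explored `u`.
    obtain ⟨q, u', hq, hsim⟩ := (hinv.similar hl hl').exists_frontier hfr
    obtain ⟨q', c', hq', hmem'⟩ := hcov' q u' hq
    obtain ⟨p', hp'⟩ := hsim.exists_leaf hq'
    exact ⟨_, mem_of_leafRecord_of_childRequests hu hrec hcov
      (by rw [subtree?_append_of_eq hu, hp']), _, hmem', rfl⟩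
  · intro hlt E₂ hE₂
    rw [pendingSize_childRequests hu] at hlt
    rw [hx, if_pos hlt]
    exact (hfail E₂ (hE₁.trans hE₂)).trans le_add_self
  · rw [hx]
    push_cast
    split_ifs with h
    · rw [← add_assoc]
      exact_mod_cast hb _ h
    · exact ha.trans le_self_add

/-- A bound for the cost of an attempt. -/
noncomputable def attemptCost (D : ℕ) (w : ℝ≥0∞) (k : ℕ) : ℝ≥0∞ :=
  2 * 2 ^ k + (4 * 2 ^ k + exploreCost D w (2 ^ k))

theorem rank_attempt_le (hinv : (T t).Invariant (T (1 - t)))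
    (hroots : ∀ s, roots s = (T s).info) (hE : ∀ s, (s, []) ∈ E)
    (hD : (T (1 - t)).maxDegree ≤ D)
    (hw : ENNReal.ofReal (2 * Real.logb 2 (T (1 - t)).size) ≤ w)
    (hfail : ∀ E', E ⊆ E' → rank T Φ fail E' ≤ b) :
    rank T Φ (attempt t roots k fail) E ≤ attemptCost D w k + b := by
  refine (rank_attempt_le_add_mul (4 * 2 ^ k + exploreCost D w (2 ^ k) + b) 0 hinv hroots hE hD hw
    hfail le_self_add fun s hs => le_self_add).trans_eq ?_
  rw [attemptCost]
  simp [add_assoc]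

theorem rank_attempt_le_of_size_le (hinv : (T t).Invariant (T (1 - t)))
    (hroots : ∀ s, roots s = (T s).info) (hE : ∀ s, (s, []) ∈ E)
    (hD : (T (1 - t)).maxDegree ≤ D)
    (hw : ENNReal.ofReal (2 * Real.logb 2 (T (1 - t)).size) ≤ w)
    (hfail : ∀ E', E ⊆ E' → rank T Φ fail E' ≤ b) (hsize : (T t).size ≤ 4 ^ k) :
    rank T Φ (attempt t roots k fail) E ≤ attemptCost D w k + b / 4 := by
  have h2 : (2 ^ k : ℝ≥0∞) ≠ 0 := by positivity
  have h2' : (2 ^ k : ℝ≥0∞) ≠ ⊤ := by finiteness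
  have h4 : (4 * 2 ^ k : ℝ≥0∞) ≠ 0 := by positivity
  have h4' : (4 * 2 ^ k : ℝ≥0∞) ≠ ⊤ := by finiteness
  refine (rank_attempt_le_add_mul (4 * 2 ^ k + exploreCost D w (2 ^ k)) (b / (4 * 2 ^ k)) hinv
    hroots hE hD hw hfail le_rfl fun s hs => ?_).trans ?_
  · gcongr
    calc b = b / (4 * 2 ^ k) * (4 * 2 ^ k) := (ENNReal.div_mul_cancel h4 h4').symm
      _ ≤ _ := by
        gcongr
        exact_mod_cast hs.le
  · rw [← attemptCost]
    refine add_le_add le_rfl ?_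
    calc b / (4 * 2 ^ k) * ((T t).size - 1 : ℕ) / (2 ^ k + 1)
        ≤ b / (4 * 2 ^ k) * (2 ^ k * 2 ^ k) / (2 ^ k) := by
          gcongr
          · calc (((T t).size - 1 : ℕ) : ℝ≥0∞) ≤ ((4 ^ k : ℕ) : ℝ≥0∞) := by
                  gcongr
                  omega
              _ = _ := by
                  rw [← mul_pow]
                  norm_num
          · exact le_self_add
      _ = b / 4 := by
          rw [mul_div_assoc, ENNReal.mul_div_cancel_right h2 h2', div_eq_mul_inv, div_eq_mul_inv,
            ENNReal.mul_inv (by simp) (by simp), ← mul_assoc, mul_assoc,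
            ENNReal.inv_mul_cancel h2 h2', mul_one]

end

/-- A bound for the expected number of steps from phase `k` on, if phase `K` is the first one in
which the smaller tree is small enough for a good chance of success. -/
noncomputable def phaseCost (Z : ℝ≥0∞) (K k : ℕ) : ℝ≥0∞ :=
  (∑ j ∈ Finset.Ico k K, 2 * Z * 2 ^ j) + 4 * Z * 2 ^ max k K

theorem two_mul_attemptCost_add_one_le (D : ℕ) (w : ℝ≥0∞) (k : ℕ) :
    attemptCost D w k + attemptCost D w k + 1 ≤ 2 * (D * (1 + w) + 9) * 2 ^ k := by
  have h1 : (1 : ℝ≥0∞) ≤ 2 ^ k := one_le_pow₀ one_le_two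
  have h2 : attemptCost D w k ≤ (D * (1 + w) + 8) * 2 ^ k := by
    calc attemptCost D w k ≤ 2 * 2 ^ k + (4 * 2 ^ k + (D * (1 + w) + 2) * (2 ^ k : ℕ)) := by
          rw [attemptCost, exploreCost, if_neg (by positivity)]
          gcongr
          exact tsub_le_self
      _ = _ := by
          push_cast
          ring
  calc _ ≤ (D * (1 + w) + 8) * 2 ^ k + (D * (1 + w) + 8) * 2 ^ k + 2 * 2 ^ k := by
        gcongr
        exact h1.trans (le_mul_of_one_le_left' one_le_two)
    _ = _ := by ring

/-- Before phase `K` both attempts are charged in full, together with the next phase. From phase `K`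
on, the attempt on the smaller tree passes on only a quarter of what follows it, which outweighs the
doubling of the cost from phase to phase. -/
theorem rank_phaseBody_le {D K k : ℕ} {w : ℝ≥0∞} {roots : Fin 2 → NodeInfo}
    (hinv : ∀ i j, (T i).Invariant (T j)) (hD : ∀ s, (T s).maxDegree ≤ D)
    (hw : ∀ s, ENNReal.ofReal (2 * Real.logb 2 (T s).size) ≤ w)
    (hK : min (T 0).size (T 1).size ≤ 4 ^ K)
    (hroots : ∀ s, roots s = (T s).info) (hE : ∀ s, (s, []) ∈ E) :
    1 + rank T (phaseCost (D * (1 + w) + 9) K) (phaseBody k roots) E ≤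
      phaseCost (D * (1 + w) + 9) K k := by
  set Z : ℝ≥0∞ := D * (1 + w) + 9 with hZ
  set R := attemptCost D w k with hR
  set b := phaseCost Z K (k + 1) with hb
  have hphase E' (hE' : E ⊆ E') : rank T (phaseCost Z K) (phase (k + 1) roots) E' ≤ b := by
    rw [rank, if_pos ⟨hroots, fun s => hE' (hE s)⟩]
  have hcost : R + R + 1 ≤ 2 * Z * 2 ^ k := two_mul_attemptCost_add_one_le D w k
  have h1 E' (hE' : E ⊆ E') : rank T (phaseCost Z K)
      (attempt 1 roots k (phase (k + 1) roots)) E' ≤ R + b :=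
    rank_attempt_le (hinv _ _) hroots (fun s => hE' (hE s)) (hD _) (hw _)
      fun E'' hE'' => hphase E'' (hE'.trans hE'')
  rw [phaseBody]
  rcases lt_or_ge k K with hk | hk
  · calc _ ≤ 1 + (R + (R + b)) := by
          gcongr
          exact rank_attempt_le (hinv _ _) hroots hE (hD _) (hw _) h1
      _ = (R + R + 1) + b := by ring
      _ ≤ 2 * Z * 2 ^ k + b := by gcongr
      _ = _ := by
          rw [hb, phaseCost, phaseCost, Finset.sum_eq_sum_Ico_succ_bot hk, max_eq_right hk.le,
            max_eq_right (Nat.succ_le_of_lt hk), add_assoc]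
  · have hpow : 4 ^ K ≤ 4 ^ k := Nat.pow_le_pow_right (by norm_num) hk
    -- The 4 in `phaseCost` solves `c = 2 + 2 * c / 4`: own cost `2 * Z * 2 ^ k` plus a quarter of
    -- the next phase, which is twice as expensive.
    have hquarter : b / 4 = 2 * Z * 2 ^ k := by
      rw [hb, phaseCost, Finset.Ico_eq_empty (by omega), max_eq_left (by omega),
        Finset.sum_empty, zero_add, pow_succ, mul_assoc, ENNReal.mul_div_right_comm,
        ENNReal.div_self (by simp) (by simp)]
      ring
    calc _ ≤ 1 + (R + (R + b / 4)) := by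
          gcongr
          rcases min_le_iff.1 (hK.trans hpow) with h0 | h0
          · refine (rank_attempt_le_of_size_le (hinv _ _) hroots hE (hD _) (hw _) h1 h0).trans ?_
            rw [ENNReal.add_div]
            gcongr
            exact ENNReal.div_le_of_le_mul (le_mul_of_one_le_right' (by norm_num))
          · exact rank_attempt_le (hinv _ _) hroots hE (hD _) (hw _) fun E' hE' =>
              rank_attempt_le_of_size_le (hinv _ _) hroots (fun s => hE' (hE s)) (hD _) (hw _)
                (fun E'' hE'' => hphase E'' (hE'.trans hE'')) h0
      _ = (R + R + 1) + 2 * Z * 2 ^ k := by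
          rw [hquarter]
          ring
      _ ≤ 2 * Z * 2 ^ k + 2 * Z * 2 ^ k := by gcongr
      _ = _ := by
          rw [phaseCost, Finset.Ico_eq_empty (by omega), max_eq_left hk, Finset.sum_empty]
          ring

theorem phaseCost_zero_le (Z : ℝ≥0∞) (K : ℕ) : phaseCost Z K 0 ≤ 6 * Z * 2 ^ K := by
  have hsum : (∑ j ∈ Finset.range K, (2 : ℝ≥0∞) ^ j) ≤ 2 ^ K := by
    exact_mod_cast (Nat.geomSum_lt (m := 2) (n := K) le_rfl (by simp)).le
  calc phaseCost Z K 0 = 2 * Z * (∑ j ∈ Finset.range K, (2 : ℝ≥0∞) ^ j) + 4 * Z * 2 ^ K := by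
        rw [phaseCost, ← Finset.mul_sum, Nat.Ico_zero_eq_range, Nat.zero_max]
    _ ≤ 2 * Z * 2 ^ K + 4 * Z * 2 ^ K := by gcongr
    _ = _ := by ring

theorem rank_start_of_leaves {c c' : ℕ} (h : ∀ s, (T s).info = .leaf (![c, c'] s))
    (hE : ∀ s, (s, []) ∈ E) : rank T Φ (start (.leaf c) (.leaf c')) E = 0 := by
  have hT s : T s = leaf (![c, c'] s) := by
    have := h s
    cases hs : T s with
    | leaf a => simpa [hs, info] using this
    | inner n f => simp [hs, info] at this
  have h0 : T 0 = leaf c := hT 0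
  have h1 : T 1 = leaf c' := hT 1
  rw [start, rank, if_pos]
  have hcolor {a d : ℕ} {p : List ℕ} (hp : (leaf a).colorAt p = some d) : d = a := by
    rw [colorAt_eq_some] at hp
    cases p with
    | nil => simpa [eq_comm] using hp
    | cons i p => simp [subtree?] at hp
  split_ifs with hc
  · subst hc
    exact ⟨hE 0, hE 1, c, by simp [colorAt_eq_some, h0], by simp [colorAt_eq_some, h1]⟩
  · rintro ⟨l₀, l₁, d, hl₀, hl₁⟩
    rw [h0] at hl₀
    rw [h1] at hl₁
    exact hc ((hcolor hl₀).symm.trans (hcolor hl₁))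

end Program

/-! ### Numerical constants and conclusion -/

theorem Real.le_four_pow_clog_and_two_pow_clog_le {n : ℕ} (hn : 0 < n) :
    n ≤ 4 ^ Nat.clog 4 n ∧ (2 : ℝ) ^ Nat.clog 4 n ≤ 2 * √n := by
  refine ⟨Nat.le_pow_clog (by norm_num) n, ?_⟩
  have h4 : 4 ^ Nat.clog 4 n ≤ 4 * n := by
    rcases Nat.lt_or_ge 1 n with h | h
    · have h1 := Nat.pow_pred_clog_lt_self (b := 4) (by norm_num) h
      have h2 : Nat.clog 4 n ≠ 0 := (Nat.clog_pos (by norm_num) h).ne'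
      rw [← Nat.succ_pred_eq_of_ne_zero h2, pow_succ]
      omega
    · obtain rfl : n = 1 := by omega
      simp
  refine abs_le_of_sq_le_sq' ?_ (by positivity) |>.2
  rw [mul_pow, Real.sq_sqrt (Nat.cast_nonneg n), ← pow_mul, mul_comm _ 2, pow_mul]
  norm_num
  exact_mod_cast h4

namespace SearchTree

theorem two_le_maxDegree_and_two_le_size {u : SearchTree} {d : ℕ} (h : u.info = .inner d) :
    2 ≤ u.maxDegree ∧ 2 ≤ u.size := by
  cases u with
  | leaf c => simp [info] at h
  | inner n f =>
    refine ⟨(Nat.le_add_left 2 n).trans (le_max_left _ _), ?_⟩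
    have := (f 0).size_pos
    have := Finset.single_le_sum (f := fun i => (f i).size) (fun _ _ => Nat.zero_le _)
      (Finset.mem_univ 0)
    simp only [size]
    omega

end SearchTree

namespace Program

open ExplorationAlgorithm SearchTree

theorem phaseCost_zero_le_ofReal {D n N : ℕ} (hD : 2 ≤ D) (hn : 0 < n) (hN : 2 ≤ N) :
    phaseCost (D * (1 + ENNReal.ofReal (2 * Real.logb 2 N)) + 9) (Nat.clog 4 n) 0 ≤
      ENNReal.ofReal (180 * D * Real.logb 2 √N * √n) := by
  have hN' : (2 : ℝ) ≤ N := by exact_mod_cast hN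
  have hD' : (2 : ℝ) ≤ D := by exact_mod_cast hD
  have hlog : Real.logb 2 √N = Real.logb 2 N / 2 := by
    rw [Real.logb, Real.log_sqrt (by positivity), Real.logb]
    ring
  have h1 : 1 ≤ Real.logb 2 N := by
    rw [Real.le_logb_iff_rpow_le one_lt_two (by positivity)]
    simpa using hN'
  have h2 := (Real.le_four_pow_clog_and_two_pow_clog_le hn).2
  rw [hlog]
  set x := Real.logb 2 (N : ℝ)
  refine (phaseCost_zero_le _ _).trans ?_
  have : (6 * (D * (1 + ENNReal.ofReal (2 * x)) + 9) * 2 ^ Nat.clog 4 n : ℝ≥0∞) =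
      ENNReal.ofReal (6 * (D * (1 + 2 * x) + 9) * 2 ^ Nat.clog 4 n) := by
    have hy : 0 ≤ 2 * x := by positivity
    generalize 2 * x = y at hy
    rw [ENNReal.ofReal_mul (by positivity), ENNReal.ofReal_mul (by positivity),
      ENNReal.ofReal_add (by positivity) (by positivity), ENNReal.ofReal_mul (by positivity),
      ENNReal.ofReal_add (by positivity) (by positivity), ENNReal.ofReal_pow (by positivity)]
    simp
  rw [this]
  refine ENNReal.ofReal_le_ofReal ?_
  -- From `D ≥ 2` and `x ≥ 1`: `D ≤ D * x` and `9 ≤ 4.5 * (D * x)`. The constant is `180 = 6 * 7.5 *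
  -- 2 * 2`, the last factor because the logarithm of `√N` is `x / 2`.
  have h3 : D * (1 + 2 * x) + 9 ≤ 7.5 * (D * x) := by nlinarith
  calc 6 * (D * (1 + 2 * x) + 9) * 2 ^ Nat.clog 4 n ≤ 6 * (7.5 * (D * x)) * (2 * √n) := by gcongr
    _ = 180 * D * (x / 2) * √n := by ring

end Program

theorem mainTheorem2 :
    ∃ (A : ExplorationAlgorithm) (C : ℝ), 0 < C ∧
      ∀ T : Fin 2 → SearchTree, (∀ i j : Fin 2, (T i).Invariant (T j)) →
        A.SolvesWithoutError T ∧
        A.expectedCost T ≤ ENNReal.ofReal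
          (C * (max (T 0).maxDegree (T 1).maxDegree : ℕ)
            * Real.logb 2 (max (√((T 0).size : ℝ)) (√((T 1).size : ℝ)))
            * min (√((T 0).size : ℝ)) (√((T 1).size : ℝ))) := by
  refine ⟨searchAlgorithm, 180, by norm_num, fun T hinv => ?_⟩
  set D := max (T 0).maxDegree (T 1).maxDegree with hDdef
  set N := max (T 0).size (T 1).size with hNdef
  set n := min (T 0).size (T 1).size with hndef
  have hsqrt : Monotone fun a : ℕ => √(a : ℝ) := fun a b h => by dsimp only; gcongr
  have hmax : max √((T 0).size : ℝ) √((T 1).size : ℝ) = √(N : ℝ) := (hsqrt.map_max).symm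
  have hmin : min √((T 0).size : ℝ) √((T 1).size : ℝ) = √(n : ℝ) := (hsqrt.map_min).symm
  rw [hmax, hmin]
  have hn : 0 < n := lt_min (T 0).size_pos (T 1).size_pos
  have hD s : (T s).maxDegree ≤ D := by
    fin_cases s
    · exact le_max_left _ _
    · exact le_max_right _ _
  have hsize s : (T s).size ≤ N := by
    fin_cases s
    · exact le_max_left _ _
    · exact le_max_right _ _
  set w := ENNReal.ofReal (2 * Real.logb 2 N) with hw
  have hw' s : ENNReal.ofReal (2 * Real.logb 2 (T s).size) ≤ w := by
    rw [hw]
    gcongr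
    · norm_num
    · exact_mod_cast (T s).size_pos
    · exact hsize s
  set Φ := Program.phaseCost (D * (1 + w) + 9) (Nat.clog 4 n) with hΦ
  set V : searchAlgorithm.Config → ℝ≥0∞ := fun c => Program.rank T Φ c.state c.explored with hV
  have hstep c (hc : ¬ searchAlgorithm.Halted c) :
      1 + (searchAlgorithm.step T c).expect V ≤ V c :=
    Program.one_add_expect_step_le (fun k roots hroots hE => Program.rank_phaseBody_le hinv hD hw'
      (Real.le_four_pow_clog_and_two_pow_clog_le hn).1 hroots hE) c.state hc
  have hout c out (ho : searchAlgorithm.move c.state = .halt out) (htop : V c < ⊤) :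
      ExplorationAlgorithm.CorrectOutput T c.explored out := by
    obtain ⟨P, E⟩ := c
    cases P with
    | halt out' =>
      obtain rfl : out' = out := by simpa [searchAlgorithm, Program.move] using ho
      by_contra h
      simp [hV, Program.rank, h] at htop
    | _ => simp [searchAlgorithm, Program.move] at ho
  have hroot s : (s, ([] : List ℕ)) ∈ (searchAlgorithm.init T).explored := by
    fin_cases s <;> simp [ExplorationAlgorithm.init]
  have hinit : V (searchAlgorithm.init T) ≤ ENNReal.ofReal (180 * D * Real.logb 2 √N * √n) := by
    -- As soon as one root is an inner node, `D` and `N` are at least 2, so the logarithm in the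
    -- bound can absorb the additive constants.
    have hphase (h : searchAlgorithm.start (T 0).info (T 1).info =
        Program.phase 0 ![(T 0).info, (T 1).info]) (h2 : 2 ≤ D ∧ 2 ≤ N) :
        V (searchAlgorithm.init T) ≤ ENNReal.ofReal (180 * D * Real.logb 2 √N * √n) := by
      have : V (searchAlgorithm.init T) = Φ 0 := by
        simp only [hV]
        rw [show (searchAlgorithm.init T).state = _ from h, Program.rank, if_pos]
        refine ⟨fun s => ?_, hroot⟩
        fin_cases s <;> rfl
      rw [this]
      exact Program.phaseCost_zero_le_ofReal h2.1 hn h2.2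
    cases h0 : (T 0).info with
    | inner d =>
      have := SearchTree.two_le_maxDegree_and_two_le_size h0
      refine hphase ?_ ⟨this.1.trans (hD 0), this.2.trans (hsize 0)⟩
      rw [h0]
      rfl
    | leaf c =>
      cases h1 : (T 1).info with
      | inner d =>
        have := SearchTree.two_le_maxDegree_and_two_le_size h1
        refine hphase ?_ ⟨this.1.trans (hD 1), this.2.trans (hsize 1)⟩
        rw [h0, h1]
        rfl
      | leaf c' =>
        have hs : (searchAlgorithm.init T).state = Program.start (.leaf c) (.leaf c') := by
          simp only [ExplorationAlgorithm.init, h0, h1]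
          rfl
        simp only [hV]
        rw [hs, Program.rank_start_of_leaves _ hroot]
        · exact zero_le
        · intro s
          fin_cases s
          · exact h0
          · exact h1
  obtain ⟨h1, h2⟩ := ExplorationAlgorithm.solves_of_ranking hstep hout
    (hinit.trans_lt ENNReal.ofReal_lt_top)
  exact ⟨h1, h2.trans hinit⟩
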